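/- Let $G$ be a (finite-dimensional, real, smooth) Lie group with Lie algebra $\mathfrak g=T_eG$ (bracket defined by left invariant vector fields), let $\mu^g:h\mapsto hg$ denote right translation, and for $X\in\mathfrak g$ let $R_X(g)=T_e(\mu^g)X$ be the associated right invariant vector field. Let $\kappa^r_g=T_g(\mu^{g^{-1}}):T_gG\to\mathfrak g$ be the right Maurer–Cartan form, $\pi:T^*G\to G$ the projection, $\Theta$ the Liouville form on $T^*G$, given by $\Theta(\Xi)=\langle \xi, T\pi.\Xi\rangle$ for $\Xi\in T_\xi(T^*G)$, and $\omega=d\Theta$. Let $\zeta^l:T^*G\to\mathfrak g^*$ be the left moment mapping, $\zeta^l_g=((\kappa^r_g)^{-1})^*=(T_e\mu^g)^*:T^*_gG\to\mathfrak g^*$, and let $\mathrm{Ad}^*(g)=\mathrm{Ad}(g^{-1})^*$ be the coadjoint representation. (a) The map $(\zeta^l,\pi):T^*G\to\mathfrak g^*\times G$ is a diffeomorphism, with inverse $(\alpha,g)\mapsto (T_g(\mu^{g^{-1}}))^*\alpha$. The operations $$(\xi,a)\cdot(\eta,b)=(\mathrm{Ad}^*(b^{-1})\xi+\eta,\;ab),\qquad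 (\xi,a)^{-1}=(-\mathrm{Ad}^*(a)\xi,\;a^{-1})$$ make $\mathfrak g^*\times G$ a Lie group (a semidirect product), and $T^*G$ becomes a Lie group by transporting this structure with $(\zeta^l,\pi)$. For $g\in G$, $\mathrm{Conj}_g(a)=gag^{-1}$ and $T^*\mathrm{Conj}_g=(T\mathrm{Conj}_{g^{-1}})^*:T^*G\to T^*G$ one has, for $\xi_a\in T_a^*G$, $$(\zeta^l,\pi)\big(T^*(\mathrm{Conj}_g)\xi_a\big)=\big(\mathrm{Ad}^*(g)\zeta^l(\xi_a),gag^{-1}\big)=(0,g)\cdot(\zeta^l(\xi_a),a)\cdot(0,g)^{-1}.$$ (b) Let $X_1,\dots,X_n$ be a basis of $\mathfrak g$, $[X_j,X_k]=\sum_i c^i_{jk}X_i$, with dual basis $\xi_1,\dots,\xi_n$ of $\mathfrak g^*$ and linear coordinates $x^i$ on $\mathfrak g^*$, $x^i(\alpha)=\langle\alpha,X_i\rangle$. Write $R_i=R_{X_i}$ and $\kappa^r=\sum_i\kappa^r_iX_i$; forms and fields on the factors are regarded as forms and fields on $\mathfrak g^*\times G$ (by pullback, respectively extension by $0$). The $2$-form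 $\omega$ and its pullback $\omega^r:=((\zeta^l,\pi)^{-1})^*\omega$ are nondegenerate, and $$\omega^r=\sum_i dx^i\wedge\kappa^r_i+\tfrac12\sum_{i,j,k}x^ic^i_{jk}\,\kappa^r_j\wedge\kappa^r_k .$$ (c) Let $\Lambda=\omega^{-1}$ be the Poisson bivector field of $\omega$, i.e. $\Lambda(i_X\omega,i_Y\omega)=\omega(X,Y)$, and let $\Lambda^r:=((\zeta^l,\pi)^{-1})^*\Lambda$ be the corresponding bivector field on $\mathfrak g^*\times G$. Then $$\Lambda^r=-\sum_i R_i\wedge\frac{\partial}{\partial x^i}-\tfrac12\sum_{i,j,k}x^ic^i_{jk}\,\frac{\partial}{\partial x^j}\wedge\frac{\partial}{\partial x^k}.$$ (d) For $f,g\in C^\infty(\mathfrak g^*\times G)$ the Poisson bracket $\{f,g\}=\Lambda^r(df,dg)$ is given by $$-\{f,g\}=\sum_i R_i(f)\frac{\partial g}{\partial x^i}-\sum_i R_i(g)\frac{\partial f}{\partial x^i}+\sum_{i,j,k}x^ic^i_{jk}\frac{\partial f}{\partial x^j}\frac{\partial g}{\partial x^k}.$$ Here $(\alpha\wedge\beta)(v,w)=\alpha(v)\beta(w)-\alpha(w)\beta(v)$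 for $1$-forms, $(X\wedge Y)(\alpha,\beta)=\alpha(X)\beta(Y)-\beta(X)\alpha(Y)$ for vector fields, and $d\theta(X,Y)=X(\theta(Y))-Y(\theta(X))-\theta([X,Y])$. -/

import Mathlib

open Bundle ContinuousAlternatingMap
open scoped Manifold ContDiff

noncomputable section

/-! ### Linear algebra on a normed space `V` (to be applied to tangent spaces) -/

section LinearAlgebra

variable {V W : Type*} [NormedAddCommGroup V] [NormedSpace ℝ V]
  [NormedAddCommGroup W] [NormedSpace ℝ W]

/-- A linear functional, regarded as an alternating `1`-form. -/
def toOneForm (a : V →L[ℝ] ℝ) : V [⋀^Fin 1]→L[ℝ] ℝ :=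
  ContinuousAlternatingMap.ofSubsingleton ℝ V ℝ (0 : Fin 1) a

/-- The wedge product of two linear functionals:
`(a ∧ b)(v, w) = a v * b w - a w * b v`, see `wedge_apply`. -/
def wedge (a b : V →L[ℝ] ℝ) : V [⋀^Fin 2]→L[ℝ] ℝ :=
  ContinuousAlternatingMap.alternatizeUncurryFin (a.smulRight (toOneForm b))

theorem wedge_apply (a b : V →L[ℝ] ℝ) (v w : V) :
    wedge a b ![v, w] = a v * b w - a w * b v := by
  simp [wedge, toOneForm, ContinuousAlternatingMap.alternatizeUncurryFin_apply,
    Fin.sum_univ_two, Fin.removeNth, sub_eq_add_neg]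

/-- Interior product `v ↦ i_v w = w(v, ·)` for a `2`-form `w`. -/
def flat (w : V [⋀^Fin 2]→L[ℝ] ℝ) : V →L[ℝ] (V →L[ℝ] ℝ) :=
  ((ContinuousAlternatingMap.ofSubsingletonLIE (0 : Fin 1) :
    (V →L[ℝ] ℝ) ≃ₗᵢ[ℝ] (V [⋀^Fin 1]→L[ℝ] ℝ)).symm.toContinuousLinearEquiv :
      (V [⋀^Fin 1]→L[ℝ] ℝ) →L[ℝ] (V →L[ℝ] ℝ)).comp w.curryLeft

theorem flat_apply (w : V [⋀^Fin 2]→L[ℝ] ℝ) (v u : V) : flat w v u = w ![v, u] := by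
  have h : ContinuousAlternatingMap.ofSubsingleton ℝ V ℝ (0 : Fin 1) (flat w v) =
      w.curryLeft v := by
    simp only [flat]
    exact (ContinuousAlternatingMap.ofSubsingletonLIE (0 : Fin 1) :
      (V →L[ℝ] ℝ) ≃ₗᵢ[ℝ] (V [⋀^Fin 1]→L[ℝ] ℝ)).apply_symm_apply (w.curryLeft v)
  have h2 := congrArg (fun F => F ![u]) h
  simpa using h2

/-- The wedge product `X ∧ Y` of two vectors, as a bivector. Bivectors on `V` are regarded as
alternating bilinear forms on the dual of `V`, so that
`(X ∧ Y)(a, b) = a X * b Y - b X * a Y`, see `vecWedge_apply`. -/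
def vecWedge (X Y : V) : (V →L[ℝ] ℝ) [⋀^Fin 2]→L[ℝ] ℝ :=
  wedge (ContinuousLinearMap.apply ℝ ℝ X) (ContinuousLinearMap.apply ℝ ℝ Y)

theorem vecWedge_apply (X Y : V) (a b : V →L[ℝ] ℝ) :
    vecWedge X Y ![a, b] = a X * b Y - b X * a Y := by
  simp [vecWedge, wedge_apply]

/-- The inverse bivector of a nondegenerate `2`-form `w`: the bivector with
`Λ (i_v w, i_u w) = w (v, u)`. -/
def inverseBivector (w : V [⋀^Fin 2]→L[ℝ] ℝ) : (V →L[ℝ] ℝ) [⋀^Fin 2]→L[ℝ] ℝ :=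
  w.compContinuousLinearMap (flat w).inverse

theorem inverseBivector_flat (w : V [⋀^Fin 2]→L[ℝ] ℝ) (hw : (flat w).IsInvertible) (v u : V) :
    inverseBivector w ![flat w v, flat w u] = w ![v, u] := by
  have h : ∀ v, (flat w).inverse (flat w v) = v := by
    obtain ⟨e, he⟩ := hw
    intro v
    simp [← he]
  simp only [inverseBivector, ContinuousAlternatingMap.compContinuousLinearMap_apply]
  congr 1
  ext i
  fin_cases i <;> simp [h]

/-- Transposition `a ↦ a ∘ A`. -/
def transposeMap (A : V →L[ℝ] W) : (W →L[ℝ] ℝ) →L[ℝ] (V →L[ℝ] ℝ) :=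
  (ContinuousLinearMap.compL ℝ V W ℝ).flip A

end LinearAlgebra

/-! ### Differential forms and bivector fields on manifolds -/

section Manifold

variable {E : Type*} [NormedAddCommGroup E] [NormedSpace ℝ E]
  {H : Type*} [TopologicalSpace H] (I : ModelWithCorners ℝ E H)
  {M : Type*} [TopologicalSpace M] [ChartedSpace H M]
  {E' : Type*} [NormedAddCommGroup E'] [NormedSpace ℝ E']
  {H' : Type*} [TopologicalSpace H'] (I' : ModelWithCorners ℝ E' H')
  {M' : Type*} [TopologicalSpace M'] [ChartedSpace H' M']

variable (M) in
/-- Differential forms of degree `n` on `M`. -/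
abbrev DiffForm (n : ℕ) := ∀ x : M, TangentSpace I x [⋀^Fin n]→L[ℝ] ℝ

variable (M) in
/-- Bivector fields on `M`. -/
abbrev BivectorField := ∀ x : M, (TangentSpace I x →L[ℝ] ℝ) [⋀^Fin 2]→L[ℝ] ℝ

/-- The exterior derivative at `x`, computed in the preferred chart at `x`. -/
def mextDeriv {n : ℕ} (w : DiffForm I M n) : DiffForm I M (n + 1) := fun x =>
  (extDerivWithin (E := E) (F := ℝ)
    (fun y : E => (w ((extChartAt I x).symm y)).compContinuousLinearMap
      (mfderivWithin 𝓘(ℝ, E) I (extChartAt I x).symm (Set.range I) y))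
    (Set.range I) (extChartAt I x x)).compContinuousLinearMap
      (mfderiv I 𝓘(ℝ, E) (extChartAt I x) x)

/-- The pullback `φ^* w` of a differential form. -/
def pullbackForm {n : ℕ} (φ : M → M') (w : DiffForm I' M' n) : DiffForm I M n := fun x =>
  (w (φ x)).compContinuousLinearMap (mfderiv I I' φ x)

/-- The pullback `φ^* Λ` of a bivector field by a (local) diffeomorphism:
`(φ^* Λ)_x (a, b) = Λ_{φ x} (a ∘ (T_x φ)⁻¹, b ∘ (T_x φ)⁻¹)`. -/
def pullbackBivector (φ : M → M') (L : BivectorField I' M') : BivectorField I M := fun x =>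
  (L (φ x)).compContinuousLinearMap
    (transposeMap (V := E') (W := E) (mfderiv I I' φ x).inverse)

/-- The pointwise wedge product of two `1`-forms. -/
def wedgeForm (a b : ∀ x : M, TangentSpace I x →L[ℝ] ℝ) : DiffForm I M 2 := fun x =>
  wedge (V := E) (a x) (b x)

/-- The pointwise wedge product of two vector fields. -/
def wedgeField (X Y : ∀ x : M, TangentSpace I x) : BivectorField I M := fun x =>
  vecWedge (V := E) (X x) (Y x)

/-- A `2`-form is nondegenerate if `v ↦ i_v w` is bijective from `T_x M` to `T_x^* M`. -/
def IsNondegenerate (w : DiffForm I M 2) : Prop :=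
  ∀ x : M, Function.Bijective (flat (V := E) (w x))

/-- The Poisson bivector field `w⁻¹` of a nondegenerate `2`-form `w`. -/
def poissonBivector (w : DiffForm I M 2) : BivectorField I M := fun x =>
  inverseBivector (V := E) (w x)

/-- The differential of a real-valued function. -/
def dFun (f : M → ℝ) (x : M) : TangentSpace I x →L[ℝ] ℝ := mfderiv I 𝓘(ℝ, ℝ) f x

/-- The bracket `{f, g} = Λ (df, dg)`. -/
def bivectorBracket (L : BivectorField I M) (f g : M → ℝ) (x : M) : ℝ :=
  L x ![dFun I f x, dFun I g x]

/-- The derivative `X(f)` of a function along a vector field. -/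
def derivAlong (X : ∀ x : M, TangentSpace I x) (f : M → ℝ) (x : M) : ℝ := dFun I f x (X x)

end Manifold

/-! ### Lie groups and their cotangent bundles -/

section LieGroups

variable {E : Type*} [NormedAddCommGroup E] [NormedSpace ℝ E]
  {H : Type*} [TopologicalSpace H] (I : ModelWithCorners ℝ E H)
  (G : Type*) [TopologicalSpace G] [ChartedSpace H G] [Group G] [LieGroup I ∞ G]

/-- The cotangent bundle `T^*G`. -/
abbrev Cotangent := TotalSpace (E →L[ℝ] ℝ) (fun g : G => TangentSpace I g →L[ℝ] Trivial G ℝ g)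

/-- The model with corners of `T^*G`. -/
abbrev cotangentModel := I.prod 𝓘(ℝ, E →L[ℝ] ℝ)

/-- The Liouville form `Θ (Ξ) = ⟨ξ, T π . Ξ⟩` on `T^*G`, for `Ξ ∈ T_ξ (T^*G)`. -/
def liouvilleForm : DiffForm (cotangentModel I) (Cotangent I G) 1 := fun ξ =>
  toOneForm (V := E × (E →L[ℝ] ℝ)) ((show E →L[ℝ] ℝ from ξ.2).comp
    (mfderiv (cotangentModel I) I (fun η : Cotangent I G => η.proj) ξ))

/-- The canonical symplectic form `ω = d Θ` on `T^*G`. -/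
def cotangentForm : DiffForm (cotangentModel I) (Cotangent I G) 2 :=
  mextDeriv (cotangentModel I) (liouvilleForm I G)

variable {G}

/-- The map `R_g : X ↦ R_X(g) = T_1(μ^g) X` from the Lie algebra to `T_g G`, where `μ^g` is the
right translation by `g`. -/
def rightInv (g : G) : GroupLieAlgebra I G →L[ℝ] TangentSpace I g :=
  mfderiv I I (fun h : G => h * g) 1

/-- The right Maurer-Cartan form `κ^r_g = T_g(μ^{g⁻¹}) : T_g G → T_1 G`. -/
def maurerCartanRight (g : G) : TangentSpace I g →L[ℝ] GroupLieAlgebra I G :=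
  mfderiv I I (fun h : G => h * g⁻¹) g

/-- The adjoint representation `Ad(g) = T_1 (h ↦ g h g⁻¹)`. -/
def adjointRep (g : G) : GroupLieAlgebra I G →L[ℝ] GroupLieAlgebra I G :=
  mfderiv I I (fun h : G => g * h * g⁻¹) 1

/-- The coadjoint representation `Ad^*(g) α = Ad(g⁻¹)^* α = α ∘ Ad(g⁻¹)` on the dual of the Lie
algebra. The dual of the Lie algebra is `E →L[ℝ] ℝ`, as the Lie algebra `T_1 G` is by definition
the model space `E`. -/
def coadjointRep (g : G) (α : E →L[ℝ] ℝ) : E →L[ℝ] ℝ :=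
  α.comp (adjointRep I g⁻¹)

variable (G) in
/-- The map `(ζ^l, π) : T^*G → 𝔤^* × G`, where `ζ^l_g = (R_g)^* : T_g^*G → 𝔤^*` is the left moment
mapping. -/
def rightTrivialization (ξ : Cotangent I G) : (E →L[ℝ] ℝ) × G :=
  ((show E →L[ℝ] ℝ from ξ.2).comp (rightInv I ξ.proj), ξ.proj)

variable (G) in
/-- The map `(α, g) ↦ (T_g(μ^{g⁻¹}))^* α`. -/
def rightTrivializationInv (p : (E →L[ℝ] ℝ) × G) : Cotangent I G :=
  ⟨p.2, p.1.comp (maurerCartanRight I p.2)⟩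

/-- The map `T^*(Conj_g) = (T Conj_{g⁻¹})^* : T_a^*G → T_{g a g⁻¹}^*G`. -/
def cotangentConj (g : G) (ξ : Cotangent I G) : Cotangent I G :=
  ⟨g * ξ.proj * g⁻¹, (show E →L[ℝ] ℝ from ξ.2).comp
    (mfderiv I I (fun h : G => g⁻¹ * h * g) (g * ξ.proj * g⁻¹))⟩

/-- The multiplication of the semidirect product `𝔤^* × G`. -/
def semidirectMul (p q : (E →L[ℝ] ℝ) × G) : (E →L[ℝ] ℝ) × G :=
  (coadjointRep I q.2⁻¹ p.1 + q.1, p.2 * q.2)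

/-- The inversion of the semidirect product `𝔤^* × G`. -/
def semidirectInv (p : (E →L[ℝ] ℝ) × G) : (E →L[ℝ] ℝ) × G :=
  (-coadjointRep I p.2 p.1, p.2⁻¹)

/-- The model with corners of `𝔤^* × G`. -/
abbrev trivialModel := 𝓘(ℝ, E →L[ℝ] ℝ).prod I

variable (G) in
/-- `ω^r = ((ζ^l, π)⁻¹)^* ω`. -/
def trivialForm : DiffForm (trivialModel I) ((E →L[ℝ] ℝ) × G) 2 :=
  pullbackForm (trivialModel I) (cotangentModel I) (rightTrivializationInv I G)
    (cotangentForm I G)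

variable (G) in
/-- `Λ^r = ((ζ^l, π)⁻¹)^* Λ`, where `Λ = ω⁻¹`. -/
def trivialBivector : BivectorField (trivialModel I) ((E →L[ℝ] ℝ) × G) :=
  pullbackBivector (trivialModel I) (cotangentModel I) (rightTrivializationInv I G)
    (poissonBivector (cotangentModel I) (cotangentForm I G))

/-! Frames and coframes of `𝔤^* × G` determined by a basis of `𝔤`. -/

section Basis

variable {ι : Type*} (X : Module.Basis ι ℝ (GroupLieAlgebra I G))

/-- The structure constants: `[X_j, X_k] = ∑ i, c^i_{jk} X_i`. -/
def structConst (i j k : ι) : ℝ := X.repr ⁅X j, X k⁆ i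

/-- The coordinate `x^i` on `𝔤^*`: the coefficient of `α` at the dual basis vector `ξ_i`. -/
def coordFun (i : ι) (α : E →L[ℝ] ℝ) : ℝ := α (X i)

/-- The `1`-form `d x^i` on `𝔤^* × G`. -/
def dCoord (i : ι) (p : (E →L[ℝ] ℝ) × G) : TangentSpace (trivialModel I) p →L[ℝ] ℝ :=
  dFun (trivialModel I) (fun q : (E →L[ℝ] ℝ) × G => coordFun I X i q.1) p

/-- The vector field `0 × R_i` on `𝔤^* × G`, where `R_i = R_{X_i}`. -/
def rightField (i : ι) (p : (E →L[ℝ] ℝ) × G) : TangentSpace (trivialModel I) p :=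
  ((0 : E →L[ℝ] ℝ), (show E from rightInv I p.2 (X i)))

variable [FiniteDimensional ℝ E]

/-- The dual basis vector `ξ_i ∈ 𝔤^*`. -/
def dualVec (i : ι) : E →L[ℝ] ℝ :=
  LinearMap.toContinuousLinearMap (E := E) (F' := ℝ) (X.coord i)

/-- The `1`-form `pr_2^* κ^r_i` on `𝔤^* × G`, where `κ^r = ∑ i, κ^r_i X_i`. -/
def kappa (i : ι) (p : (E →L[ℝ] ℝ) × G) : TangentSpace (trivialModel I) p →L[ℝ] ℝ :=
  ((dualVec I X i).comp (maurerCartanRight I p.2)).comp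
    (mfderiv (trivialModel I) I (fun q : (E →L[ℝ] ℝ) × G => q.2) p)

/-- The vector field `∂/∂x^i` (extended by zero) on `𝔤^* × G`. -/
def partialField (i : ι) (p : (E →L[ℝ] ℝ) × G) : TangentSpace (trivialModel I) p :=
  (dualVec I X i, (0 : E))

end Basis

end LieGroups

end

noncomputable section

section Translations

variable {E : Type*} [NormedAddCommGroup E] [NormedSpace ℝ E]
  {H : Type*} [TopologicalSpace H] (I : ModelWithCorners ℝ E H)
  {G : Type*} [TopologicalSpace G] [ChartedSpace H G]

/-- The tangent map of a self-map of a manifold, read in the model space. -/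
def tangentEnd (f : G → G) (x : G) : E →L[ℝ] E := mfderiv I I f x

variable {I}

theorem tangentEnd_comp {f g : G → G} {x y : G} (hg : MDifferentiableAt I I g y)
    (hf : MDifferentiableAt I I f x) (h : f x = y) :
    (tangentEnd I g y).comp (tangentEnd I f x) = tangentEnd I (fun z => g (f z)) x := by
  subst h
  exact (mfderiv_comp x hg hf).symm

theorem tangentEnd_id (x : G) : tangentEnd I (fun z : G => z) x = ContinuousLinearMap.id ℝ E :=
  mfderiv_id

variable [Group G] [LieGroup I ∞ G]

theorem mdifferentiable_conj (a b : G) : MDifferentiable I I (fun h : G => a * h * b) :=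
  ((contMDiff_mul_right (I := I) (n := ∞) (a := b)).comp
    (contMDiff_mul_left (I := I) (n := ∞) (a := a))).mdifferentiable (by simp)

theorem mdifferentiable_mul_right' (b : G) : MDifferentiable I I (fun h : G => h * b) :=
  (contMDiff_mul_right (I := I) (n := ∞) (a := b)).mdifferentiable (by simp)

omit [LieGroup I ∞ G] in
theorem adjointRep_eq (g : G) :
    (adjointRep I g : E →L[ℝ] E) = tangentEnd I (fun h => g * h * g⁻¹) 1 := rfl

theorem maurerCartanRight_comp_rightInv (g : G) :
    (show E →L[ℝ] E from maurerCartanRight I g).comp (show E →L[ℝ] E from rightInv I g) =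
      ContinuousLinearMap.id ℝ E := by
  have := tangentEnd_comp (I := I) (mdifferentiable_mul_right' g⁻¹ g)
    (mdifferentiable_mul_right' g 1) (one_mul g)
  simp only [mul_inv_cancel_right] at this
  rw [tangentEnd_id] at this
  exact this

theorem rightInv_comp_maurerCartanRight (g : G) :
    (show E →L[ℝ] E from rightInv I g).comp (show E →L[ℝ] E from maurerCartanRight I g) =
      ContinuousLinearMap.id ℝ E := by
  have := tangentEnd_comp (I := I) (mdifferentiable_mul_right' g 1)
    (mdifferentiable_mul_right' g⁻¹ g) (mul_inv_cancel g)
  simp only [inv_mul_cancel_right] at this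
  rw [tangentEnd_id] at this
  exact this

theorem adjointRep_mul (a b : G) :
    (adjointRep I (a * b) : E →L[ℝ] E) =
      (show E →L[ℝ] E from adjointRep I a).comp (show E →L[ℝ] E from adjointRep I b) := by
  have := tangentEnd_comp (I := I) (mdifferentiable_conj a a⁻¹ 1) (mdifferentiable_conj b b⁻¹ 1)
    (by simp)
  rw [adjointRep_eq]
  refine Eq.trans ?_ this.symm
  congr 1
  ext z
  group

omit [LieGroup I ∞ G] in
theorem adjointRep_one : (adjointRep I (1 : G) : E →L[ℝ] E) = ContinuousLinearMap.id ℝ E := by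
  rw [adjointRep_eq]
  simp only [one_mul, inv_one, mul_one]
  exact tangentEnd_id 1

omit [LieGroup I ∞ G] in
theorem coadjointRep_apply (g : G) (α : E →L[ℝ] ℝ) (v : E) :
    coadjointRep I g α v = α ((adjointRep I g⁻¹ : E →L[ℝ] E) v) := rfl

theorem coadjointRep_mul (a b : G) (α : E →L[ℝ] ℝ) :
    coadjointRep I (a * b) α = coadjointRep I a (coadjointRep I b α) := by
  ext v
  simp only [coadjointRep_apply, mul_inv_rev, adjointRep_mul]
  rfl

theorem coadjointRep_one (α : E →L[ℝ] ℝ) : coadjointRep I (1 : G) α = α := by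
  ext v
  rw [coadjointRep_apply, inv_one, adjointRep_one]
  rfl

omit [LieGroup I ∞ G] in
theorem coadjointRep_add (g : G) (α β : E →L[ℝ] ℝ) :
    coadjointRep I g (α + β) = coadjointRep I g α + coadjointRep I g β := rfl

omit [LieGroup I ∞ G] in
theorem coadjointRep_neg (g : G) (α : E →L[ℝ] ℝ) :
    coadjointRep I g (-α) = -coadjointRep I g α := rfl

omit [LieGroup I ∞ G] in
theorem coadjointRep_zero (g : G) : coadjointRep I g (0 : E →L[ℝ] ℝ) = 0 := rfl

variable (I G) in
/-- The semidirect product group structure on `𝔤^* × G`. -/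
abbrev semidirectGroup : Group ((E →L[ℝ] ℝ) × G) where
  mul := semidirectMul I
  one := (0, 1)
  inv := semidirectInv I
  mul_assoc a b c := by
    change semidirectMul I (semidirectMul I a b) c = semidirectMul I a (semidirectMul I b c)
    simp only [semidirectMul, coadjointRep_add, mul_inv_rev, coadjointRep_mul, add_assoc, mul_assoc]
  one_mul a := by
    change semidirectMul I (0, 1) a = a
    simp [semidirectMul, coadjointRep_zero]
  mul_one a := by
    change semidirectMul I a (0, 1) = a
    simp [semidirectMul, coadjointRep_one]
  inv_mul_cancel a := by
    change semidirectMul I (semidirectInv I a) a = (0, 1)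
    simp [semidirectMul, semidirectInv, coadjointRep_neg, ← coadjointRep_mul, coadjointRep_one]

variable (I G) in
/-- The right trivialization of `T^*G`, as a bijection. -/
def rightTrivializationEquiv : Cotangent I G ≃ (E →L[ℝ] ℝ) × G where
  toFun := rightTrivialization I G
  invFun := rightTrivializationInv I G
  left_inv ξ := by
    obtain ⟨g, p⟩ := ξ
    refine congrArg (TotalSpace.mk g) ?_
    change (show E →L[ℝ] ℝ from p).comp ((show E →L[ℝ] E from rightInv I g).comp
      (show E →L[ℝ] E from maurerCartanRight I g)) = p
    rw [rightInv_comp_maurerCartanRight]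
    rfl
  right_inv p := by
    obtain ⟨α, g⟩ := p
    refine Prod.ext ?_ rfl
    change α.comp ((show E →L[ℝ] E from maurerCartanRight I g).comp
      (show E →L[ℝ] E from rightInv I g)) = α
    rw [maurerCartanRight_comp_rightInv]
    rfl

theorem rightTrivialization_cotangentConj (g : G) (ξ : Cotangent I G) :
    rightTrivialization I G (cotangentConj I g ξ) =
      (coadjointRep I g (rightTrivialization I G ξ).1, g * ξ.proj * g⁻¹) := by
  obtain ⟨a, p⟩ := ξ
  refine Prod.ext ?_ rfl
  change (show E →L[ℝ] ℝ from p).comp ((tangentEnd I (fun h : G => g⁻¹ * h * g) (g * a * g⁻¹)).comp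
    (tangentEnd I (fun h : G => h * (g * a * g⁻¹)) 1)) =
    (show E →L[ℝ] ℝ from p).comp ((tangentEnd I (fun h : G => h * a) 1).comp
    (tangentEnd I (fun h : G => g⁻¹ * h * g⁻¹⁻¹) 1))
  rw [tangentEnd_comp (mdifferentiable_conj _ _ _) (mdifferentiable_mul_right' _ _) (by simp),
    tangentEnd_comp (mdifferentiable_mul_right' _ _) (mdifferentiable_conj _ _ _) (by simp)]
  congr 2
  ext z
  group

omit [LieGroup I ∞ G] in
theorem semidirectMul_conj (g : G) (p : (E →L[ℝ] ℝ) × G) :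
    semidirectMul I (semidirectMul I (0, g) p) (semidirectInv I (0, g)) =
      (coadjointRep I g p.1, g * p.2 * g⁻¹) := by
  simp [semidirectMul, semidirectInv, coadjointRep_zero]

end Translations

section Smoothness

variable {E : Type*} [NormedAddCommGroup E] [NormedSpace ℝ E]
  {H : Type*} [TopologicalSpace H] (I : ModelWithCorners ℝ E H)
  {G : Type*} [TopologicalSpace G] [ChartedSpace H G]

/-- The derivative of the preferred chart at `x₀`, as an endomorphism of the model space. -/
def chartDeriv (x₀ x : G) : E →L[ℝ] E := mfderiv I 𝓘(ℝ, E) (extChartAt I x₀) x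

/-- The derivative of the inverse of the preferred chart at `x₀`, at the image of `x`, as an
endomorphism of the model space. -/
def chartSymmDeriv (x₀ x : G) : E →L[ℝ] E :=
  mfderivWithin 𝓘(ℝ, E) I (extChartAt I x₀).symm (Set.range I) (extChartAt I x₀ x)

variable {I} [IsManifold I 1 G]

theorem chartDeriv_self (x : G) : chartDeriv I x x = ContinuousLinearMap.id ℝ E :=
  mfderiv_extChartAt_self

theorem chartSymmDeriv_self (x : G) : chartSymmDeriv I x x = ContinuousLinearMap.id ℝ E :=
  mfderivWithin_range_extChartAt_symm

theorem chartSymmDeriv_comp_chartDeriv {x₀ x : G} (hx : x ∈ (chartAt H x₀).source) :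
    (chartSymmDeriv I x₀ x).comp (chartDeriv I x₀ x) = ContinuousLinearMap.id ℝ E :=
  mfderivWithin_extChartAt_symm_comp_mfderiv_extChartAt' (by simpa using hx)

theorem inTangentCoordinates_eq_chartDeriv_comp {N : Type*} {f g : N → G} {ϕ : N → E →L[ℝ] E}
    {x₀ x : N} (hx : f x ∈ (chartAt H (f x₀)).source) (hy : g x ∈ (chartAt H (g x₀)).source) :
    inTangentCoordinates I I f g ϕ x₀ x =
      (chartDeriv I (g x₀) (g x)).comp ((ϕ x).comp (chartSymmDeriv I (f x₀) (f x))) :=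
  inTangentCoordinates_eq_mfderiv_comp (ϕ := ϕ) hx hy

omit [IsManifold I 1 G] in
theorem eventually_mem_chart_source (x₀ : G) : ∀ᶠ x in nhds x₀, x ∈ (chartAt H x₀).source :=
  (chartAt H x₀).open_source.mem_nhds (mem_chart_source H x₀)

/-- A covector in the preferred trivialization of the cotangent bundle. -/
theorem inCoordinates_cotangent {x₀ x : G} (hx : x ∈ (chartAt H x₀).source)
    (p : TangentSpace I x →L[ℝ] Trivial G ℝ x) :
    ContinuousLinearMap.inCoordinates E (TangentSpace I) ℝ (Trivial G ℝ) x₀ x x₀ x p =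
      (show E →L[ℝ] ℝ from p).comp (chartSymmDeriv I x₀ x) := by
  have h := TangentBundle.symmL_trivializationAt (I := I) hx
  ext v
  simp only [ContinuousLinearMap.inCoordinates, h, ContinuousLinearMap.comp_apply]
  simp
  rfl

variable [Group G] [LieGroup I ∞ G]

theorem contMDiffAt_maurerCartanRight (x₀ : G) :
    ContMDiffAt I 𝓘(ℝ, E →L[ℝ] E) ∞
      (fun x => (show E →L[ℝ] E from maurerCartanRight I x).comp (chartSymmDeriv I x₀ x)) x₀ := by
  have h := ContMDiffAt.mfderiv (I := I) (I' := I) (J := I) (n := ∞) (m := ∞) (x₀ := x₀)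
    (fun (x h : G) => h * x⁻¹) (fun x => x)
    (contMDiff_snd.mul contMDiff_fst.inv).contMDiffAt contMDiffAt_id le_rfl
  simp only [mul_inv_cancel] at h
  refine h.congr_of_eventuallyEq ?_
  filter_upwards [eventually_mem_chart_source (H := H) x₀] with x hx
  refine Eq.trans ?_ (inTangentCoordinates_eq_chartDeriv_comp
    (ϕ := fun x => tangentEnd I (fun h : G => h * x⁻¹) x) hx (mem_chart_source H (1 : G))).symm
  rw [chartDeriv_self]
  rfl

theorem contMDiffAt_rightInv (x₀ : G) :
    ContMDiffAt I 𝓘(ℝ, E →L[ℝ] E) ∞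
      (fun x => (chartDeriv I x₀ x).comp (show E →L[ℝ] E from rightInv I x)) x₀ := by
  have h := ContMDiffAt.mfderiv (I := I) (I' := I) (J := I) (n := ∞) (m := ∞) (x₀ := x₀)
    (fun (x h : G) => h * x) (fun _ => 1)
    (contMDiff_snd.mul contMDiff_fst).contMDiffAt contMDiffAt_const le_rfl
  simp only [one_mul] at h
  refine h.congr_of_eventuallyEq ?_
  filter_upwards [eventually_mem_chart_source (H := H) x₀] with x hx
  refine Eq.trans ?_ (inTangentCoordinates_eq_chartDeriv_comp
    (ϕ := fun x => tangentEnd I (fun h : G => h * x) 1) (mem_chart_source H (1 : G)) hx).symm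
  rw [chartSymmDeriv_self]
  rfl

theorem contMDiff_adjointRep :
    ContMDiff I 𝓘(ℝ, E →L[ℝ] E) ∞ (fun x : G => (show E →L[ℝ] E from adjointRep I x)) := by
  intro x₀
  have h := ContMDiffAt.mfderiv (I := I) (I' := I) (J := I) (n := ∞) (m := ∞) (x₀ := x₀)
    (fun (x h : G) => x * h * x⁻¹) (fun _ => 1)
    ((contMDiff_fst.mul contMDiff_snd).mul contMDiff_fst.inv).contMDiffAt contMDiffAt_const le_rfl
  simp only [mul_one, mul_inv_cancel] at h
  refine h.congr_of_eventuallyEq (Filter.Eventually.of_forall fun x => ?_)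
  refine Eq.trans ?_ (inTangentCoordinates_eq_chartDeriv_comp
    (ϕ := fun x => tangentEnd I (fun h : G => x * h * x⁻¹) 1) (f := fun _ => 1) (g := fun _ => 1)
    (mem_chart_source H (1 : G)) (mem_chart_source H (1 : G))).symm
  rw [chartSymmDeriv_self, chartDeriv_self]
  rfl

theorem contMDiff_rightTrivialization :
    ContMDiff (cotangentModel I) (trivialModel I) ∞ (rightTrivialization I G) := by
  intro ξ₀
  have hproj : ContMDiff (cotangentModel I) I ∞ (fun ξ : Cotangent I G => ξ.proj) :=
    contMDiff_proj _
  refine ContMDiffAt.prodMk ?_ hproj.contMDiffAt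
  have h1 := ((contMDiffAt_hom_bundle (IM := cotangentModel I) (IB := I) (n := ∞)
    (fun ξ : Cotangent I G => ξ)).1 (contMDiffAt_id (x := ξ₀))).2
  have h2 := (contMDiffAt_rightInv (I := I) ξ₀.proj).comp ξ₀ hproj.contMDiffAt
  refine (h1.clm_comp h2).congr_of_eventuallyEq ?_
  filter_upwards [hproj.continuous.continuousAt.eventually
    (eventually_mem_chart_source (H := H) ξ₀.proj)] with ξ hξ
  rw [inCoordinates_cotangent hξ]
  change (show E →L[ℝ] ℝ from ξ.2).comp (show E →L[ℝ] E from rightInv I ξ.proj) =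
    (show E →L[ℝ] ℝ from ξ.2).comp (((chartSymmDeriv I ξ₀.proj ξ.proj).comp
      (chartDeriv I ξ₀.proj ξ.proj)).comp (show E →L[ℝ] E from rightInv I ξ.proj))
  rw [chartSymmDeriv_comp_chartDeriv hξ]
  rfl

theorem contMDiff_rightTrivializationInv :
    ContMDiff (trivialModel I) (cotangentModel I) ∞ (rightTrivializationInv I G) := by
  intro p₀
  refine (contMDiffAt_hom_bundle (IM := trivialModel I) (IB := I) (n := ∞) _).2
    ⟨contMDiffAt_snd, ?_⟩
  have hsnd : ContMDiff (trivialModel I) I ∞ (fun p : (E →L[ℝ] ℝ) × G => p.2) := contMDiff_snd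
  have h2 := (contMDiffAt_maurerCartanRight (I := I) p₀.2).comp p₀ hsnd.contMDiffAt
  have h1 : ContMDiff (trivialModel I) 𝓘(ℝ, E →L[ℝ] ℝ) ∞
      (fun p : (E →L[ℝ] ℝ) × G => p.1) := contMDiff_fst
  refine (h1.contMDiffAt.clm_comp h2).congr_of_eventuallyEq ?_
  filter_upwards [continuous_snd.continuousAt.eventually
    (eventually_mem_chart_source (H := H) p₀.2)] with p hp
  exact inCoordinates_cotangent (I := I) hp _

variable (I G) in
/-- The right trivialization `(ζ^l, π)` as a diffeomorphism. -/
def rightTrivializationDiffeomorph :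
    Diffeomorph (cotangentModel I) (trivialModel I) (Cotangent I G) ((E →L[ℝ] ℝ) × G) ∞ where
  toEquiv := rightTrivializationEquiv I G
  contMDiff_toFun := contMDiff_rightTrivialization
  contMDiff_invFun := contMDiff_rightTrivializationInv

theorem contMDiff_semidirectMul :
    ContMDiff ((trivialModel I).prod (trivialModel I)) (trivialModel I) ∞
      (fun p : ((E →L[ℝ] ℝ) × G) × ((E →L[ℝ] ℝ) × G) => semidirectMul I p.1 p.2) := by
  refine ContMDiff.prodMk (ContMDiff.add (ContMDiff.clm_comp contMDiff_fst.fst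
    (contMDiff_adjointRep.comp contMDiff_snd.snd.inv.inv)) contMDiff_snd.fst) (contMDiff_fst.snd.mul contMDiff_snd.snd)

theorem contMDiff_semidirectInv :
    ContMDiff (trivialModel I) (trivialModel I) ∞
      (fun p : (E →L[ℝ] ℝ) × G => semidirectInv I p) := by
  refine ContMDiff.prodMk (ContMDiff.neg (ContMDiff.clm_comp contMDiff_fst
    (contMDiff_adjointRep.comp contMDiff_snd.inv))) contMDiff_snd.inv

theorem lieGroup_semidirect :
    @LieGroup ℝ _ _ _ _ _ _ (trivialModel I) ∞ ((E →L[ℝ] ℝ) × G) (semidirectGroup I G) _ _ := by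
  have : IsManifold I ∞ G := inferInstance
  let := semidirectGroup I G
  exact { contMDiff_mul := contMDiff_semidirectMul, contMDiff_inv := contMDiff_semidirectInv }

variable (I G) in
/-- The group structure on `T^*G` for which the right trivialization is an isomorphism. -/
abbrev cotangentGroup : Group (Cotangent I G) :=
  letI := semidirectGroup I G
  (rightTrivializationEquiv I G).group

theorem lieGroup_cotangent :
    @LieGroup ℝ _ _ _ _ _ _ (cotangentModel I) ∞ (Cotangent I G) (cotangentGroup I G) _ _ := by
  have : IsManifold I ∞ G := inferInstance
  let := cotangentGroup I G
  refine { contMDiff_mul := ?_, contMDiff_inv := ?_ }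
  · exact contMDiff_rightTrivializationInv.comp (contMDiff_semidirectMul.comp
      ((contMDiff_rightTrivialization.comp contMDiff_fst).prodMk
        (contMDiff_rightTrivialization.comp contMDiff_snd)))
  · exact contMDiff_rightTrivializationInv.comp (contMDiff_semidirectInv.comp
      contMDiff_rightTrivialization)

end Smoothness

/-- The exterior derivative of a `1`-form with linear coefficients. -/
theorem extDeriv_toOneForm_linear {V : Type*} [NormedAddCommGroup V] [NormedSpace ℝ V]
    (A : V →L[ℝ] (V →L[ℝ] ℝ)) (y u v : V) :
    extDeriv (fun z => toOneForm (A z)) y ![u, v] = A u v - A v u := by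
  let e := (ContinuousAlternatingMap.ofSubsingletonLIE (0 : Fin 1) :
      (V →L[ℝ] ℝ) ≃ₗᵢ[ℝ] (V [⋀^Fin 1]→L[ℝ] ℝ))
  have hL : HasFDerivAt (fun z => toOneForm (A z))
      ((e.toContinuousLinearEquiv : (V →L[ℝ] ℝ) →L[ℝ] (V [⋀^Fin 1]→L[ℝ] ℝ)).comp A) y :=
    e.toContinuousLinearEquiv.hasFDerivAt.comp y A.hasFDerivAt
  have hA : ∀ c, fderiv ℝ (fun x => A x c) y = A.flip c := fun c => (A.flip c).fderiv
  rw [extDeriv_apply hL.differentiableAt]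
  simp [Fin.sum_univ_two, Fin.removeNth, sub_eq_add_neg, toOneForm, hA]

section CanonicalForm

variable {E : Type*} [NormedAddCommGroup E] [NormedSpace ℝ E]
  {H : Type*} [TopologicalSpace H] {I : ModelWithCorners ℝ E H} [I.Boundaryless]
  {G : Type*} [TopologicalSpace G] [ChartedSpace H G] [Group G] [LieGroup I ∞ G]

omit [I.Boundaryless] in
theorem extChartAt_cotangent_apply {ξ₀ ξ : Cotangent I G}
    (hξ : ξ.proj ∈ (chartAt H ξ₀.proj).source) :
    extChartAt (cotangentModel I) ξ₀ ξ = (extChartAt I ξ₀.proj ξ.proj,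
      (show E →L[ℝ] ℝ from ξ.2).comp (chartSymmDeriv I ξ₀.proj ξ.proj)) := by
  rw [← inCoordinates_cotangent hξ ξ.2]
  exact congrArg (I.prod 𝓘(ℝ, E →L[ℝ] ℝ)) (hom_chart (HB := H) ξ₀ ξ)

omit [I.Boundaryless] in
theorem proj_mem_of_mem_extChartAt_cotangent_source {ξ₀ ξ : Cotangent I G}
    (h : ξ ∈ (extChartAt (cotangentModel I) ξ₀).source) : ξ.proj ∈ (chartAt H ξ₀.proj).source := by
  rw [extChartAt_source, FiberBundle.chartedSpace_chartAt] at h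
  simp only [OpenPartialHomeomorph.trans_source, Set.mem_inter_iff] at h
  exact h.1.1

/-- The Liouville form in the preferred chart is `p dq`. -/
theorem liouvilleForm_chart (ξ₀ : Cotangent I G) {y : E × (E →L[ℝ] ℝ)}
    (hy : y ∈ (extChartAt (cotangentModel I) ξ₀).target) :
    ((liouvilleForm I G ((extChartAt (cotangentModel I) ξ₀).symm y)).compContinuousLinearMap
      (mfderivWithin 𝓘(ℝ, E × (E →L[ℝ] ℝ)) (cotangentModel I)
        (extChartAt (cotangentModel I) ξ₀).symm (Set.range (cotangentModel I)) y) :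
        (E × (E →L[ℝ] ℝ)) [⋀^Fin 1]→L[ℝ] ℝ) =
      toOneForm (y.2.comp (ContinuousLinearMap.fst ℝ E (E →L[ℝ] ℝ))) := by
  have hr : Set.range (cotangentModel I) = Set.univ := ModelWithCorners.Boundaryless.range_eq_univ
  have hrI : Set.range I = Set.univ := ModelWithCorners.Boundaryless.range_eq_univ
  have hcoord : ∀ z ∈ (extChartAt (cotangentModel I) ξ₀).target,
      ((extChartAt (cotangentModel I) ξ₀).symm z).proj ∈ (chartAt H ξ₀.proj).source ∧
      z = (extChartAt I ξ₀.proj ((extChartAt (cotangentModel I) ξ₀).symm z).proj,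
        (show E →L[ℝ] ℝ from ((extChartAt (cotangentModel I) ξ₀).symm z).2).comp
          (chartSymmDeriv I ξ₀.proj ((extChartAt (cotangentModel I) ξ₀).symm z).proj)) := by
    intro z hz
    have h := proj_mem_of_mem_extChartAt_cotangent_source
      ((extChartAt (cotangentModel I) ξ₀).map_target hz)
    refine ⟨h, ?_⟩
    rw [← extChartAt_cotangent_apply h, PartialEquiv.right_inv _ hz]
  obtain ⟨hη, hyη⟩ := hcoord y hy
  have hy1 : y.1 = extChartAt I ξ₀.proj ((extChartAt (cotangentModel I) ξ₀).symm y).proj :=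
    congrArg Prod.fst hyη
  have hy2 : y.2 = (show E →L[ℝ] ℝ from ((extChartAt (cotangentModel I) ξ₀).symm y).2).comp
      (chartSymmDeriv I ξ₀.proj ((extChartAt (cotangentModel I) ξ₀).symm y).proj) :=
    congrArg Prod.snd hyη
  have hproj : MDifferentiableAt (cotangentModel I) I (fun η : Cotangent I G => η.proj)
      ((extChartAt (cotangentModel I) ξ₀).symm y) :=
    ((contMDiff_proj (fun g : G => TangentSpace I g →L[ℝ] Trivial G ℝ g)
      (IB := I) (n := ∞)).mdifferentiable (by simp)) _
  have hsymm : MDifferentiableAt 𝓘(ℝ, E × (E →L[ℝ] ℝ)) (cotangentModel I)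
      (extChartAt (cotangentModel I) ξ₀).symm y := by
    rw [← mdifferentiableWithinAt_univ, ← hr]
    exact mdifferentiableWithinAt_extChartAt_symm hy
  have hy1t : y.1 ∈ (extChartAt I ξ₀.proj).target := by
    rw [hy1]
    exact (extChartAt I ξ₀.proj).map_source (by simpa using hη)
  have hsymmI : MDifferentiableAt 𝓘(ℝ, E) I (extChartAt I ξ₀.proj).symm y.1 := by
    rw [← mdifferentiableWithinAt_univ, ← hrI]
    exact mdifferentiableWithinAt_extChartAt_symm hy1t
  have hev : (fun z => ((extChartAt (cotangentModel I) ξ₀).symm z).proj) =ᶠ[nhds y]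
      fun z => (extChartAt I ξ₀.proj).symm z.1 := by
    filter_upwards [(isOpen_extChartAt_target (I := cotangentModel I) ξ₀).mem_nhds hy] with z hz
    obtain ⟨h, hz'⟩ := hcoord z hz
    have hz1 : z.1 = extChartAt I ξ₀.proj ((extChartAt (cotangentModel I) ξ₀).symm z).proj :=
      congrArg Prod.fst hz'
    rw [hz1, PartialEquiv.left_inv _ (by simpa using h)]
  have hfst : HasMFDerivAt 𝓘(ℝ, E × (E →L[ℝ] ℝ)) 𝓘(ℝ, E) (Prod.fst : E × (E →L[ℝ] ℝ) → E) y
      (ContinuousLinearMap.fst ℝ E (E →L[ℝ] ℝ)) :=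
    (ContinuousLinearMap.fst ℝ E (E →L[ℝ] ℝ)).hasMFDerivAt
  have h1 := (hproj.hasMFDerivAt.comp y hsymm.hasMFDerivAt).congr_of_eventuallyEq hev.symm
  have h2 := hsymmI.hasMFDerivAt.comp y hfst
  have h3 := hasMFDerivAt_unique h1 h2
  have h4 : chartSymmDeriv I ξ₀.proj ((extChartAt (cotangentModel I) ξ₀).symm y).proj =
      mfderiv 𝓘(ℝ, E) I (extChartAt I ξ₀.proj).symm y.1 := by
    unfold chartSymmDeriv
    rw [← hy1, hrI, mfderivWithin_univ]
  rw [hr, mfderivWithin_univ, hy2, h4]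
  ext w
  exact congrArg (show E →L[ℝ] ℝ from ((extChartAt (cotangentModel I) ξ₀).symm y).2)
    (DFunLike.congr_fun h3 (w 0))

theorem cotangentForm_apply (ξ : Cotangent I G) (u v : E × (E →L[ℝ] ℝ)) :
    (show (E × (E →L[ℝ] ℝ)) [⋀^Fin 2]→L[ℝ] ℝ from cotangentForm I G ξ) ![u, v] =
      u.2 v.1 - v.2 u.1 := by
  have hr : Set.range (cotangentModel I) = Set.univ := ModelWithCorners.Boundaryless.range_eq_univ
  let w : (E × (E →L[ℝ] ℝ)) → (E × (E →L[ℝ] ℝ)) [⋀^Fin 1]→L[ℝ] ℝ := fun y =>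
    (liouvilleForm I G ((extChartAt (cotangentModel I) ξ).symm y)).compContinuousLinearMap
      (mfderivWithin 𝓘(ℝ, E × (E →L[ℝ] ℝ)) (cotangentModel I)
        (extChartAt (cotangentModel I) ξ).symm (Set.range (cotangentModel I)) y)
  have hw : w =ᶠ[nhds (extChartAt (cotangentModel I) ξ ξ)]
      fun z => toOneForm (z.2.comp (ContinuousLinearMap.fst ℝ E (E →L[ℝ] ℝ))) := by
    filter_upwards [extChartAt_target_mem_nhds (I := cotangentModel I) ξ] with y hy
    exact liouvilleForm_chart ξ hy
  have key : (cotangentForm I G ξ : (E × (E →L[ℝ] ℝ)) [⋀^Fin 2]→L[ℝ] ℝ) =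
      extDeriv w (extChartAt (cotangentModel I) ξ ξ) := by
    rw [← extDerivWithin_univ, ← hr]
    unfold cotangentForm mextDeriv
    rw [mfderiv_extChartAt_self]
    ext z
    rfl
  rw [hw.extDeriv_eq] at key
  exact (congrArg (fun F : (E × (E →L[ℝ] ℝ)) [⋀^Fin 2]→L[ℝ] ℝ => F ![u, v]) key).trans
    (extDeriv_toOneForm_linear (((ContinuousLinearMap.compL ℝ (E × (E →L[ℝ] ℝ)) E ℝ).flip
      (ContinuousLinearMap.fst ℝ E (E →L[ℝ] ℝ))).comp
        (ContinuousLinearMap.snd ℝ E (E →L[ℝ] ℝ))) _ u v)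

end CanonicalForm

section TrivialForm

variable {E : Type*} [NormedAddCommGroup E] [NormedSpace ℝ E]
  {H : Type*} [TopologicalSpace H] {I : ModelWithCorners ℝ E H} [I.Boundaryless]
  {G : Type*} [TopologicalSpace G] [ChartedSpace H G] [Group G] [LieGroup I ∞ G]

variable (I) in
/-- The right Maurer-Cartan form at `g`, as an endomorphism of the model space. -/
def maurerCartanEnd (g : G) : E →L[ℝ] E := maurerCartanRight I g

variable (I) in
/-- The trivialization of the tangent bundle by right translations, as an endomorphism of the
model space. -/
def rightInvEnd (g : G) : E →L[ℝ] E := rightInv I g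

omit [I.Boundaryless] in
theorem maurerCartanEnd_rightInvEnd (g : G) (v : E) :
    maurerCartanEnd I g (rightInvEnd I g v) = v :=
  DFunLike.congr_fun (maurerCartanRight_comp_rightInv (I := I) g) v

omit [I.Boundaryless] in
theorem rightInvEnd_maurerCartanEnd (g : G) (v : E) :
    rightInvEnd I g (maurerCartanEnd I g v) = v :=
  DFunLike.congr_fun (rightInv_comp_maurerCartanRight (I := I) g) v

variable (I) in
/-- The right Maurer-Cartan form in the preferred chart at `g`. -/
def maurerCartanChart (g : G) (q : E) : E →L[ℝ] E :=
  (maurerCartanEnd I ((extChartAt I g).symm q)).comp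
    (chartSymmDeriv I g ((extChartAt I g).symm q))

omit [I.Boundaryless] in
theorem maurerCartanChart_self (g : G) :
    maurerCartanChart I g (extChartAt I g g) = maurerCartanEnd I g := by
  unfold maurerCartanChart
  rw [extChartAt_to_inv, chartSymmDeriv_self]
  rfl

theorem differentiableAt_maurerCartanChart (g : G) :
    DifferentiableAt ℝ (maurerCartanChart I g) (extChartAt I g g) := by
  have hr : Set.range I = Set.univ := ModelWithCorners.Boundaryless.range_eq_univ
  have h1 : ContMDiffAt 𝓘(ℝ, E) I ∞ (extChartAt I g).symm (extChartAt I g g) := by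
    rw [← contMDiffWithinAt_univ, ← hr]
    exact contMDiffWithinAt_extChartAt_symm_range g (mem_extChartAt_target g)
  have h2 := (contMDiffAt_maurerCartanRight (I := I) g).comp_of_eq h1 (extChartAt_to_inv g)
  exact h2.contDiffAt.differentiableAt (by simp)

variable (I) in
/-- The derivative of `(α, g) ↦ (T_g(μ^{g⁻¹}))^* α`. -/
def rightTrivializationInvDeriv (p : (E →L[ℝ] ℝ) × G) :
    ((E →L[ℝ] ℝ) × E) →L[ℝ] (E × (E →L[ℝ] ℝ)) :=
  (ContinuousLinearMap.snd ℝ (E →L[ℝ] ℝ) E).prod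
    (((ContinuousLinearMap.compL ℝ E E ℝ).flip (maurerCartanChart I p.2 (extChartAt I p.2 p.2))).comp
      (ContinuousLinearMap.fst ℝ (E →L[ℝ] ℝ) E) +
    (ContinuousLinearMap.compL ℝ E E ℝ p.1).comp
      ((fderiv ℝ (maurerCartanChart I p.2) (extChartAt I p.2 p.2)).comp
        (ContinuousLinearMap.snd ℝ (E →L[ℝ] ℝ) E)))

theorem hasMFDerivAt_rightTrivializationInv (p : (E →L[ℝ] ℝ) × G) :
    HasMFDerivAt (trivialModel I) (cotangentModel I) (rightTrivializationInv I G) p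
      (rightTrivializationInvDeriv I p) := by
  refine ⟨contMDiff_rightTrivializationInv.continuous.continuousAt, ?_⟩
  obtain ⟨α, g⟩ := p
  let F : (E →L[ℝ] ℝ) × E → E × (E →L[ℝ] ℝ) := fun z =>
    (z.2, z.1.comp (maurerCartanChart I g z.2))
  have hF : HasFDerivAt F (rightTrivializationInvDeriv I (α, g)) (α, extChartAt I g g) := by
    refine HasFDerivAt.prodMk hasFDerivAt_snd ?_
    have h := (hasFDerivAt_fst (𝕜 := ℝ) (p := (α, extChartAt I g g))).clm_comp
      ((differentiableAt_maurerCartanChart (I := I) g).hasFDerivAt.comp (α, extChartAt I g g)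
        hasFDerivAt_snd)
    rw [add_comm]
    exact h
  refine HasFDerivAt.hasFDerivWithinAt (HasFDerivAt.congr_of_eventuallyEq hF ?_)
  have ht : ∀ᶠ z : (E →L[ℝ] ℝ) × E in nhds (α, extChartAt I g g), z.2 ∈ (extChartAt I g).target :=
    continuous_snd.continuousAt.eventually (extChartAt_target_mem_nhds (I := I) g)
  filter_upwards [ht] with z hz
  have hs := (extChartAt I g).map_target hz
  have hs' : (extChartAt I g).symm z.2 ∈ (chartAt H g).source := by simpa using hs
  refine (extChartAt_cotangent_apply (I := I) (G := G) (ξ₀ := rightTrivializationInv I G (α, g))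
    (ξ := rightTrivializationInv I G (z.1, (extChartAt I g).symm z.2)) hs').trans ?_
  refine Prod.ext ((extChartAt I g).right_inv hz) rfl

theorem trivialForm_apply_chart (p : (E →L[ℝ] ℝ) × G) (u v : (E →L[ℝ] ℝ) × E) :
    (show ((E →L[ℝ] ℝ) × E) [⋀^Fin 2]→L[ℝ] ℝ from trivialForm I G p) ![u, v] =
      u.1 (maurerCartanEnd I p.2 v.2) -
      v.1 (maurerCartanEnd I p.2 u.2) +
      p.1 (fderiv ℝ (maurerCartanChart I p.2) (extChartAt I p.2 p.2) u.2 v.2 -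
        fderiv ℝ (maurerCartanChart I p.2) (extChartAt I p.2 p.2) v.2 u.2) := by
  have h := (hasMFDerivAt_rightTrivializationInv (I := I) p).mfderiv
  have h1 : (show ((E →L[ℝ] ℝ) × E) [⋀^Fin 2]→L[ℝ] ℝ from trivialForm I G p) ![u, v] =
      (show (E × (E →L[ℝ] ℝ)) [⋀^Fin 2]→L[ℝ] ℝ from
        cotangentForm I G (rightTrivializationInv I G p))
        ![rightTrivializationInvDeriv I p u, rightTrivializationInvDeriv I p v] := by
    rw [← h]
    refine congrArg (show (E × (E →L[ℝ] ℝ)) [⋀^Fin 2]→L[ℝ] ℝ from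
        cotangentForm I G (rightTrivializationInv I G p)) ?_
    ext i : 1
    fin_cases i <;> rfl
  rw [h1, cotangentForm_apply, ← maurerCartanChart_self]
  simp only [rightTrivializationInvDeriv, ContinuousLinearMap.prod_apply, map_sub]
  simp
  ring

end TrivialForm

section MaurerCartan

variable {E : Type*} [NormedAddCommGroup E] [NormedSpace ℝ E]
  {H : Type*} [TopologicalSpace H] {I : ModelWithCorners ℝ E H}
  {G : Type*} [TopologicalSpace G] [ChartedSpace H G] [Group G] [LieGroup I ∞ G]

theorem mdifferentiable_inv_group : MDifferentiable I I (fun h : G => h⁻¹) :=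
  (contMDiff_inv I ∞).mdifferentiable (by simp)

theorem tangentEnd_inv_one_apply (v : E) :
    tangentEnd I (fun h : G => h⁻¹) 1 v = -v := by
  have hm : MDifferentiableAt (I.prod I) I (fun p : G × G => p.1 * p.2) (1, (1 : G)⁻¹) :=
    (contMDiff_mul I ∞).mdifferentiable (by simp) _
  have hi : HasMFDerivAt I (I.prod I) (fun h : G => (h, h⁻¹)) 1
      ((ContinuousLinearMap.id ℝ E).prod (tangentEnd I (fun h : G => h⁻¹) 1)) :=
    (hasMFDerivAt_id (1 : G)).prodMk (mdifferentiable_inv_group (I := I) (1 : G)).hasMFDerivAt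
  have h := hm.hasMFDerivAt.comp (1 : G) hi
  have hc : (fun p : G × G => p.1 * p.2) ∘ (fun h : G => (h, h⁻¹)) = fun _ => 1 := by
    ext h
    simp
  rw [hc] at h
  have h0 := DFunLike.congr_fun (hasMFDerivAt_unique h (hasMFDerivAt_const (1 : G) (1 : G))) v
  have h1 := mfderiv_prod_eq_add_apply (I := I) (I' := I) (I'' := I) hm
    (v := (v, tangentEnd I (fun h : G => h⁻¹) 1 v))
  have h2 : tangentEnd I (fun z : G => z * (1 : G)⁻¹) 1 v +
      tangentEnd I (fun z : G => 1 * z) (1 : G)⁻¹ (tangentEnd I (fun h : G => h⁻¹) 1 v) = 0 :=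
    h1.symm.trans h0
  simp only [inv_one, mul_one, one_mul, tangentEnd_id, ContinuousLinearMap.id_apply] at h2
  exact eq_neg_of_add_eq_zero_right h2

theorem isInvertible_mfderiv_inv (g : G) : (mfderiv I I (fun h : G => h⁻¹) g).IsInvertible := by
  have h1 := tangentEnd_comp (I := I) (mdifferentiable_inv_group (g⁻¹)) (mdifferentiable_inv_group g)
    rfl
  have h2 := tangentEnd_comp (I := I) (mdifferentiable_inv_group g) (mdifferentiable_inv_group g⁻¹)
    (inv_inv g)
  simp only [inv_inv, tangentEnd_id] at h1 h2
  let T : E →L[ℝ] E := tangentEnd I (fun h : G => h⁻¹) g⁻¹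
  exact ContinuousLinearMap.IsInvertible.of_inverse (g := T) h2 h1

variable (I G) in
/-- The Lie bracket of the Lie algebra of `G`, read in the model space. -/
def modelBracket (X Y : E) : E :=
  Bracket.bracket (L := GroupLieAlgebra I G) (M := GroupLieAlgebra I G) X Y

variable (I G) in
/-- The pullback of the left invariant vector field of `X` under inversion. -/
def invPullbackField (X : E) (g : G) : TangentSpace I g :=
  VectorField.mpullback I I (fun h : G => h⁻¹)
    (mulInvariantVectorField (show GroupLieAlgebra I G from X)) g

theorem invPullbackField_eq (X : E) (g : G) :
    invPullbackField I G X g = (-rightInvEnd I g X : E) := by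
  obtain ⟨e, he⟩ := isInvertible_mfderiv_inv (I := I) g
  unfold invPullbackField
  rw [VectorField.mpullback_apply, ← he, ContinuousLinearMap.inverse_equiv]
  refine (e.symm_apply_eq).2 ?_
  have h1 := tangentEnd_comp (I := I) (mdifferentiable_inv_group g)
    (mdifferentiable_mul_right' g 1) (one_mul g)
  have hl : MDifferentiable I I (fun h : G => g⁻¹ * h) :=
    (contMDiff_mul_left (I := I) (n := ∞)).mdifferentiable (by simp)
  have h2 := tangentEnd_comp (I := I) (hl (1 : G)⁻¹)
    (mdifferentiable_inv_group (1 : G)) rfl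
  simp only [mul_inv_rev] at h1
  have h3 := DFunLike.congr_fun (h1.trans h2.symm) X
  have h4 : tangentEnd I (fun h : G => h⁻¹) g (-rightInvEnd I g X) =
      tangentEnd I (fun h : G => g⁻¹ * h) 1 X := by
    rw [map_neg, neg_eq_iff_eq_neg]
    refine h3.trans ?_
    rw [ContinuousLinearMap.comp_apply, tangentEnd_inv_one_apply, map_neg, inv_one]
  rw [← ContinuousLinearEquiv.coe_coe, he]
  exact h4.symm

theorem lieGroup_minSmoothness : LieGroup I (minSmoothness ℝ 3) G :=
  LieGroup.of_le (n := ∞) (by simpa using ENat.LEInfty.out)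

/-- Right invariant vector fields, up to sign, are closed under the Lie bracket. -/
theorem mlieBracket_invPullbackField [CompleteSpace E] (X Y : E) (g : G) :
    VectorField.mlieBracket I (invPullbackField I G X) (invPullbackField I G Y) g =
      (-rightInvEnd I g (modelBracket I G X Y) : E) := by
  have : LieGroup I (minSmoothness ℝ 3) G := lieGroup_minSmoothness
  have key : ∀ X Y : GroupLieAlgebra I G, VectorField.mlieBracket I
      (VectorField.mpullback I I (fun h : G => h⁻¹) (mulInvariantVectorField X))
      (VectorField.mpullback I I (fun h : G => h⁻¹) (mulInvariantVectorField Y)) g =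
      VectorField.mpullback I I (fun h : G => h⁻¹) (mulInvariantVectorField ⁅X, Y⁆) g := by
    intro X Y
    rw [GroupLieAlgebra.bracket_def, mulInvariantVector_mlieBracket]
    exact (VectorField.mpullback_mlieBracket (n := ∞)
      (mdifferentiableAt_mulInvariantVectorField X) (mdifferentiableAt_mulInvariantVectorField Y)
      (contMDiff_inv I ∞).contMDiffAt (by simpa using ENat.LEInfty.out)).symm
  rw [← invPullbackField_eq]
  exact key X Y

theorem mdifferentiableAt_invPullbackField [CompleteSpace E] (X : E) (g : G) :
    MDifferentiableAt I I.tangent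
      (fun x => (TotalSpace.mk' E x (invPullbackField I G X x) : TangentBundle I G)) g := by
  have : LieGroup I (minSmoothness ℝ 3) G := lieGroup_minSmoothness
  exact MDifferentiableAt.mpullback_vectorField (n := ∞)
    (mdifferentiableAt_mulInvariantVectorField _)
    (contMDiff_inv I ∞).contMDiffAt (isInvertible_mfderiv_inv g)
    ENat.LEInfty.out

variable (I) in
/-- The field `invPullbackField I G X` in the preferred chart at `g`. -/
def invPullbackChart (g : G) (X : E) : E → E :=
  VectorField.mpullbackWithin 𝓘(ℝ, E) I (extChartAt I g).symm (invPullbackField I G X)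
    (Set.range I)

theorem maurerCartanChart_invPullbackChart (g : G) (X : E) {q : E}
    (hq : q ∈ (extChartAt I g).target) :
    maurerCartanChart I g q (invPullbackChart I g X q) = -X := by
  obtain ⟨e, he⟩ := isInvertible_mfderivWithin_extChartAt_symm hq
  have h1 : chartSymmDeriv I g ((extChartAt I g).symm q) (invPullbackChart I g X q) =
      -rightInvEnd I ((extChartAt I g).symm q) X := by
    refine Eq.trans ?_ (invPullbackField_eq X _)
    unfold chartSymmDeriv
    rw [(extChartAt I g).right_inv hq]
    change mfderivWithin 𝓘(ℝ, E) I (extChartAt I g).symm (Set.range I) q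
      ((mfderivWithin 𝓘(ℝ, E) I (extChartAt I g).symm (Set.range I) q).inverse _) = _
    rw [← he, ContinuousLinearMap.inverse_equiv]
    exact e.apply_symm_apply _
  refine (congrArg (maurerCartanEnd I ((extChartAt I g).symm q)) h1).trans ?_
  rw [map_neg, maurerCartanEnd_rightInvEnd]

theorem invPullbackChart_self (g : G) (X : E) :
    invPullbackChart I g X (extChartAt I g g) = -rightInvEnd I g X := by
  have h := maurerCartanChart_invPullbackChart (I := I) g X (mem_extChartAt_target g)
  rw [maurerCartanChart_self] at h
  rw [← rightInvEnd_maurerCartanEnd (I := I) g (invPullbackChart I g X _), h, map_neg]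

variable [I.Boundaryless]

theorem differentiableAt_invPullbackChart [CompleteSpace E] (g : G) (X : E) :
    DifferentiableAt ℝ (invPullbackChart I g X) (extChartAt I g g) := by
  have hr : Set.range I = Set.univ := ModelWithCorners.Boundaryless.range_eq_univ
  have h : DifferentiableWithinAt ℝ (invPullbackChart I g X)
      ((extChartAt I g).symm ⁻¹' Set.univ ∩ Set.range I) (extChartAt I g g) :=
    MDifferentiableWithinAt.differentiableWithinAt_mpullbackWithin_vectorField
      (s := Set.univ) (mdifferentiableAt_invPullbackField X g).mdifferentiableWithinAt
  simpa [hr, differentiableWithinAt_univ] using h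

theorem lieBracket_invPullbackChart [CompleteSpace E] (g : G) (X Y : E) :
    VectorField.lieBracket ℝ (invPullbackChart I g X) (invPullbackChart I g Y)
      (extChartAt I g g) = -rightInvEnd I g (modelBracket I G X Y) := by
  have hr : Set.range I = Set.univ := ModelWithCorners.Boundaryless.range_eq_univ
  refine Eq.trans ?_ (mlieBracket_invPullbackField (I := I) X Y g)
  rw [← VectorField.mlieBracketWithin_univ, VectorField.mlieBracketWithin_apply,
    mfderiv_extChartAt_self]
  have h : ∀ v : E, (ContinuousLinearMap.id ℝ E).inverse v = v := fun v => by
    rw [ContinuousLinearMap.inverse_id]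
    rfl
  refine Eq.trans ?_ (h _).symm
  rw [Set.preimage_univ, Set.univ_inter]
  change _ = VectorField.lieBracketWithin ℝ (invPullbackChart I g X) (invPullbackChart I g Y)
    (Set.range I) (extChartAt I g g)
  rw [hr, VectorField.lieBracketWithin_univ]

/-- The Maurer-Cartan equation, read in the preferred chart. -/
theorem fderiv_maurerCartanChart_sub [CompleteSpace E] (g : G) (X Y : E) :
    fderiv ℝ (maurerCartanChart I g) (extChartAt I g g) (rightInvEnd I g X) (rightInvEnd I g Y) -
      fderiv ℝ (maurerCartanChart I g) (extChartAt I g g) (rightInvEnd I g Y)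
        (rightInvEnd I g X) = modelBracket I G X Y := by
  have hderiv : ∀ X v, maurerCartanEnd I g (fderiv ℝ (invPullbackChart I g X)
      (extChartAt I g g) v) = fderiv ℝ (maurerCartanChart I g) (extChartAt I g g) v
        (rightInvEnd I g X) := by
    intro X v
    have h1 := (differentiableAt_maurerCartanChart (I := I) g).hasFDerivAt.clm_apply
      (differentiableAt_invPullbackChart g X).hasFDerivAt
    have h2 : (fun q => maurerCartanChart I g q (invPullbackChart I g X q))
        =ᶠ[nhds (extChartAt I g g)] fun _ => -X := by
      filter_upwards [extChartAt_target_mem_nhds (I := I) g] with q hq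
      exact maurerCartanChart_invPullbackChart g X hq
    have h3 := h1.unique ((hasFDerivAt_const _ _).congr_of_eventuallyEq h2)
    have h4 := DFunLike.congr_fun h3 v
    rw [maurerCartanChart_self, invPullbackChart_self] at h4
    rw [← sub_eq_zero]
    simpa [sub_eq_add_neg] using h4
  have h5 := congrArg (maurerCartanEnd I g) (lieBracket_invPullbackChart (I := I) g X Y)
  rw [VectorField.lieBracket, map_neg, maurerCartanEnd_rightInvEnd, map_sub, hderiv, hderiv,
    invPullbackChart_self, invPullbackChart_self, map_neg, map_neg] at h5
  rw [← neg_inj, ← h5]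
  simp only [_root_.neg_apply]
  abel

/-- The form `ω^r` in the trivialization of the tangent bundle by right translations. -/
theorem trivialForm_apply [CompleteSpace E] (p : (E →L[ℝ] ℝ) × G) (a b : E →L[ℝ] ℝ) (X Y : E) :
    (show ((E →L[ℝ] ℝ) × E) [⋀^Fin 2]→L[ℝ] ℝ from trivialForm I G p)
      ![(a, rightInvEnd I p.2 X), (b, rightInvEnd I p.2 Y)] =
      a Y - b X + p.1 (modelBracket I G X Y) := by
  rw [trivialForm_apply_chart, fderiv_maurerCartanChart_sub]
  simp only [maurerCartanEnd_rightInvEnd]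

end MaurerCartan

section SymplecticAlgebra

variable {V W : Type*} [NormedAddCommGroup V] [NormedSpace ℝ V]
  [NormedAddCommGroup W] [NormedSpace ℝ W]

theorem bijective_flat [FiniteDimensional ℝ V] (w : V [⋀^Fin 2]→L[ℝ] ℝ)
    (h : ∀ u, (∀ v, w ![u, v] = 0) → u = 0) : Function.Bijective (flat w) := by
  have hinj : Function.Injective (flat w : V →ₗ[ℝ] (V →L[ℝ] ℝ)) := by
    rw [injective_iff_map_eq_zero]
    intro u hu
    refine h u fun v => ?_
    rw [← flat_apply]
    exact DFunLike.congr_fun hu v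
  have hfin : Module.finrank ℝ V = Module.finrank ℝ (V →L[ℝ] ℝ) := by
    rw [← (LinearMap.toContinuousLinearMap (𝕜 := ℝ) (E := V) (F' := ℝ)).finrank_eq]
    exact (Subspace.dual_finrank_eq (K := ℝ) (V := V)).symm
  exact ⟨hinj, (LinearMap.injective_iff_surjective_of_finrank_eq_finrank hfin).1 hinj⟩

theorem isInvertible_of_bijective [FiniteDimensional ℝ V] {f : V →L[ℝ] W}
    (hf : Function.Bijective f) : f.IsInvertible := by
  let e : V ≃ₗ[ℝ] W := LinearEquiv.ofBijective (f : V →ₗ[ℝ] W) hf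
  have : FiniteDimensional ℝ W := e.finiteDimensional
  exact ⟨e.toContinuousLinearEquiv, by ext; rfl⟩

theorem inverseBivector_transpose (w : W [⋀^Fin 2]→L[ℝ] ℝ) (hw : (flat w).IsInvertible)
    {f : V →L[ℝ] W} (hf : f.IsInvertible) (u v : V) :
    (inverseBivector w).compContinuousLinearMap (transposeMap f.inverse)
      ![flat (w.compContinuousLinearMap f) u, flat (w.compContinuousLinearMap f) v] =
      w ![f u, f v] := by
  obtain ⟨e, rfl⟩ := hf
  rw [← inverseBivector_flat w hw]
  have h : ∀ u, transposeMap (e : V →L[ℝ] W).inverse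
      (flat (w.compContinuousLinearMap (e : V →L[ℝ] W)) u) = flat w (e u) := by
    intro u
    ext z
    rw [ContinuousLinearMap.inverse_equiv, flat_apply]
    change flat (w.compContinuousLinearMap (e : V →L[ℝ] W)) u (e.symm z) = _
    rw [flat_apply, compContinuousLinearMap_apply]
    congr 1
    ext i
    fin_cases i <;> simp
  rw [compContinuousLinearMap_apply]
  congr 1
  ext i : 1
  fin_cases i
  · exact h u
  · exact h v

variable {ι : Type*} [Fintype ι] {E : Type*} [NormedAddCommGroup E] [NormedSpace ℝ E]

theorem sum_basis_mul_repr (X : Module.Basis ι ℝ E) (a : E →ₗ[ℝ] ℝ) (y : E) :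
    ∑ i, a (X i) * X.repr y i = a y := by
  conv_rhs => rw [← X.sum_repr y, _root_.map_sum]
  simp [mul_comm]

/-- Expansion of a skew bilinear form in a basis. -/
theorem sum_structConst_mul (X : Module.Basis ι ℝ E) (β : E →ₗ[ℝ] E →ₗ[ℝ] ℝ)
    (hβ : ∀ x y, β y x = -β x y) (C : ι → ι → ι → ℝ)
    (hC : ∀ j k, ∑ i, C i j k = β (X j) (X k)) (x y : E) :
    ∑ i, ∑ j, ∑ k, C i j k * (X.repr x j * X.repr y k - X.repr y j * X.repr x k) =
      2 * β x y := by
  have h : ∀ x y, ∑ j, ∑ k, β (X j) (X k) * (X.repr x j * X.repr y k) = β x y := by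
    intro x y
    have h1 : ∀ j, ∑ k, β (X j) (X k) * (X.repr x j * X.repr y k) =
        β.flip y (X j) * X.repr x j := by
      intro j
      rw [LinearMap.flip_apply, ← sum_basis_mul_repr X (β (X j)) y, Finset.sum_mul]
      exact Finset.sum_congr rfl fun k _ => by ring
    rw [Finset.sum_congr rfl fun j _ => h1 j, sum_basis_mul_repr X (β.flip y) x]
    rfl
  rw [Finset.sum_comm]
  simp_rw [Finset.sum_comm (s := Finset.univ (α := ι)) (t := Finset.univ (α := ι))
    (f := fun i k => C i _ k * _), ← Finset.sum_mul, hC, mul_sub, Finset.sum_sub_distrib, h, hβ x y]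
  ring

end SymplecticAlgebra

section MainFormulas

variable {E : Type*} [NormedAddCommGroup E] [NormedSpace ℝ E] [FiniteDimensional ℝ E]
  {H : Type*} [TopologicalSpace H] {I : ModelWithCorners ℝ E H} [I.Boundaryless]
  {G : Type*} [TopologicalSpace G] [ChartedSpace H G] [Group G] [LieGroup I ∞ G]

omit [FiniteDimensional ℝ E] in
theorem eq_zero_of_forall_functional {x : E} (h : ∀ a : E →L[ℝ] ℝ, a x = 0) : x = 0 :=
  SeparatingDual.eq_zero_of_forall_dual_eq_zero (R := ℝ) h

theorem isNondegenerate_cotangentForm :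
    IsNondegenerate (cotangentModel I) (cotangentForm I G) := by
  intro ξ
  refine bijective_flat (V := E × (E →L[ℝ] ℝ)) _ fun u hu => ?_
  have h : ∀ v : E × (E →L[ℝ] ℝ), u.2 v.1 - v.2 u.1 = 0 := fun v =>
    (cotangentForm_apply ξ u v).symm.trans (hu v)
  refine Prod.ext (eq_zero_of_forall_functional fun a => ?_) ?_
  · simpa using h (0, a)
  · ext e
    simpa using h (e, 0)

variable (I G) in
/-- The pairing of a functional with the Lie bracket, as a bilinear form. -/
def bracketForm (α : E →L[ℝ] ℝ) : E →ₗ[ℝ] E →ₗ[ℝ] ℝ :=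
  have : LieGroup I (minSmoothness ℝ 3) G := lieGroup_minSmoothness
  LinearMap.mk₂ ℝ (fun X Y => α (modelBracket I G X Y))
    (fun X Y Z => (congrArg α (add_lie (L := GroupLieAlgebra I G) (M := GroupLieAlgebra I G)
      X Y Z)).trans (map_add α _ _))
    (fun c X Y => (congrArg α (smul_lie (L := GroupLieAlgebra I G) (M := GroupLieAlgebra I G)
      c X Y)).trans (map_smul α _ _))
    (fun X Y Z => (congrArg α (lie_add (L := GroupLieAlgebra I G) (M := GroupLieAlgebra I G)
      X Y Z)).trans (map_add α _ _))
    (fun c X Y => (congrArg α (lie_smul (L := GroupLieAlgebra I G) (M := GroupLieAlgebra I G)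
      c X Y)).trans (map_smul α _ _))

omit [I.Boundaryless] in
theorem bracketForm_apply (α : E →L[ℝ] ℝ) (x y : E) :
    bracketForm I G α x y = α (modelBracket I G x y) := rfl

omit [I.Boundaryless] in
theorem bracketForm_swap (α : E →L[ℝ] ℝ) (x y : E) :
    bracketForm I G α y x = -bracketForm I G α x y := by
  have : LieGroup I (minSmoothness ℝ 3) G := lieGroup_minSmoothness
  rw [bracketForm_apply, bracketForm_apply, ← map_neg]
  exact congrArg α (lie_skew (L := GroupLieAlgebra I G) y x).symm

theorem isNondegenerate_trivialForm :
    IsNondegenerate (trivialModel I) (trivialForm I G) := by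
  intro p
  refine bijective_flat (V := (E →L[ℝ] ℝ) × E) _ fun u hu => ?_
  obtain ⟨a, w⟩ := u
  rw [← rightInvEnd_maurerCartanEnd (I := I) p.2 w] at hu ⊢
  have h : ∀ (b : E →L[ℝ] ℝ) (Y : E), a Y - b (maurerCartanEnd I p.2 w) +
      bracketForm I G p.1 (maurerCartanEnd I p.2 w) Y = 0 := fun b Y =>
    (trivialForm_apply p a b _ Y).symm.trans (hu (b, rightInvEnd I p.2 Y))
  have hX : maurerCartanEnd I p.2 w = 0 :=
    eq_zero_of_forall_functional fun b => by simpa using h b 0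
  rw [hX] at h ⊢
  refine Prod.ext ?_ (map_zero _)
  ext Y
  simpa using h 0 Y

theorem trivialBivector_flat (p : (E →L[ℝ] ℝ) × G) (u v : (E →L[ℝ] ℝ) × E) :
    (show (((E →L[ℝ] ℝ) × E) →L[ℝ] ℝ) [⋀^Fin 2]→L[ℝ] ℝ from trivialBivector I G p)
      ![flat (V := (E →L[ℝ] ℝ) × E) (trivialForm I G p) u,
        flat (V := (E →L[ℝ] ℝ) × E) (trivialForm I G p) v] =
      (show ((E →L[ℝ] ℝ) × E) [⋀^Fin 2]→L[ℝ] ℝ from trivialForm I G p) ![u, v] := by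
  have hω : (flat (V := E × (E →L[ℝ] ℝ))
      (cotangentForm I G (rightTrivializationInv I G p))).IsInvertible :=
    isInvertible_of_bijective (V := E × (E →L[ℝ] ℝ)) (isNondegenerate_cotangentForm _)
  let f : ((E →L[ℝ] ℝ) × E) →L[ℝ] (E × (E →L[ℝ] ℝ)) :=
    mfderiv (trivialModel I) (cotangentModel I) (rightTrivializationInv I G) p
  have hf : f.IsInvertible :=
    ⟨(rightTrivializationDiffeomorph I G).symm.mfderivToContinuousLinearEquiv (by simp) p, rfl⟩
  refine (inverseBivector_transpose (V := (E →L[ℝ] ℝ) × E) (W := E × (E →L[ℝ] ℝ))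
    (cotangentForm I G (rightTrivializationInv I G p)) hω hf u v).trans ?_
  refine congrArg (show (E × (E →L[ℝ] ℝ)) [⋀^Fin 2]→L[ℝ] ℝ from
    cotangentForm I G (rightTrivializationInv I G p)) ?_
  ext i : 1
  fin_cases i <;> rfl

end MainFormulas

section BasisFormulas

variable {E : Type*} [NormedAddCommGroup E] [NormedSpace ℝ E] [FiniteDimensional ℝ E]
  {H : Type*} [TopologicalSpace H] {I : ModelWithCorners ℝ E H}
  {G : Type*} [TopologicalSpace G] [ChartedSpace H G] [Group G] [LieGroup I ∞ G]
  {ι : Type*} (X : Module.Basis ι ℝ (GroupLieAlgebra I G))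

/-- A basis of the Lie algebra, as a basis of the model space. -/
def modelBasis : Module.Basis ι ℝ E := X

theorem structConst_swap (i j k : ι) : structConst I X i k j = -structConst I X i j k := by
  have : LieGroup I (minSmoothness ℝ 3) G := lieGroup_minSmoothness
  unfold structConst
  rw [← lie_skew, map_neg]
  rfl

theorem sum_coordFun_mul_structConst [Fintype ι] (α : E →L[ℝ] ℝ) (j k : ι) :
    ∑ i, coordFun I X i α * structConst I X i j k =
      bracketForm I G α (modelBasis X j) (modelBasis X k) :=
  sum_basis_mul_repr (modelBasis X) (α : E →ₗ[ℝ] ℝ) _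

omit [FiniteDimensional ℝ E] [LieGroup I ∞ G] in
theorem dCoord_apply (i : ι) (p : (E →L[ℝ] ℝ) × G) (u : (E →L[ℝ] ℝ) × E) :
    (show ((E →L[ℝ] ℝ) × E) →L[ℝ] ℝ from dCoord I X i p) u = u.1 (modelBasis X i) := by
  have h : HasMFDerivAt (trivialModel I) 𝓘(ℝ, ℝ)
      (fun q : (E →L[ℝ] ℝ) × G => coordFun I X i q.1) p
      ((ContinuousLinearMap.apply ℝ ℝ (modelBasis X i)).comp
        (ContinuousLinearMap.fst ℝ (E →L[ℝ] ℝ) E)) :=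
    (ContinuousLinearMap.apply ℝ ℝ (modelBasis X i)).hasMFDerivAt.comp p (hasMFDerivAt_fst p)
  exact DFunLike.congr_fun h.mfderiv u

omit [LieGroup I ∞ G] in
theorem kappa_apply (i : ι) (p : (E →L[ℝ] ℝ) × G) (u : (E →L[ℝ] ℝ) × E) :
    (show ((E →L[ℝ] ℝ) × E) →L[ℝ] ℝ from kappa I X i p) u =
      (modelBasis X).repr (maurerCartanEnd I p.2 u.2) i := by
  have h := DFunLike.congr_fun (hasMFDerivAt_snd (I := 𝓘(ℝ, E →L[ℝ] ℝ)) (I' := I) p).mfderiv u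
  exact congrArg (fun w : E => (modelBasis X).repr (maurerCartanEnd I p.2 w) i) h

variable [Fintype ι] [I.Boundaryless]

theorem trivialForm_eq (p : (E →L[ℝ] ℝ) × G) :
    trivialForm I G p =
      ∑ i, wedgeForm (trivialModel I) (dCoord I X i) (kappa I X i) p +
      (1 / 2 : ℝ) • ∑ i, ∑ j, ∑ k, (coordFun I X i p.1 * structConst I X i j k) •
        wedgeForm (trivialModel I) (kappa I X j) (kappa I X k) p := by
  let dx : ι → ((E →L[ℝ] ℝ) × E) →L[ℝ] ℝ := fun i => dCoord I X i p
  let κ : ι → ((E →L[ℝ] ℝ) × E) →L[ℝ] ℝ := fun i => kappa I X i p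
  change (show ((E →L[ℝ] ℝ) × E) [⋀^Fin 2]→L[ℝ] ℝ from trivialForm I G p) =
    ∑ i, wedge (dx i) (κ i) + (1 / 2 : ℝ) • ∑ i, ∑ j, ∑ k,
      (coordFun I X i p.1 * structConst I X i j k) • wedge (κ j) (κ k)
  ext w
  obtain ⟨a, x, hu⟩ : ∃ a x, w 0 = (a, rightInvEnd I p.2 x) :=
    ⟨(w 0).1, maurerCartanEnd I p.2 (w 0).2, by rw [rightInvEnd_maurerCartanEnd]⟩
  obtain ⟨b, y, hv⟩ : ∃ b y, w 1 = (b, rightInvEnd I p.2 y) :=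
    ⟨(w 1).1, maurerCartanEnd I p.2 (w 1).2, by rw [rightInvEnd_maurerCartanEnd]⟩
  have hw : w = ![(a, rightInvEnd I p.2 x), (b, rightInvEnd I p.2 y)] := by
    ext i : 1
    fin_cases i
    · exact hu
    · exact hv
  have hdx : ∀ i u, dx i u = u.1 (modelBasis X i) := fun i u => dCoord_apply X i p u
  have hκ : ∀ i u, κ i u = (modelBasis X).repr (maurerCartanEnd I p.2 u.2) i :=
    fun i u => kappa_apply X i p u
  rw [hw, trivialForm_apply]
  simp only [ContinuousAlternatingMap.add_apply, ContinuousAlternatingMap.sum_apply,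
    ContinuousAlternatingMap.smul_apply, wedge_apply, hdx, hκ, maurerCartanEnd_rightInvEnd,
    smul_eq_mul, Finset.sum_sub_distrib]
  have h1 : ∑ i, a (modelBasis X i) * (modelBasis X).repr y i = a y :=
    sum_basis_mul_repr (modelBasis X) (a : E →ₗ[ℝ] ℝ) y
  have h2 : ∑ i, b (modelBasis X i) * (modelBasis X).repr x i = b x :=
    sum_basis_mul_repr (modelBasis X) (b : E →ₗ[ℝ] ℝ) x
  have h3 := sum_structConst_mul (modelBasis X) (bracketForm I G p.1) (bracketForm_swap p.1)
    (fun i j k => coordFun I X i p.1 * structConst I X i j k)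
    (sum_coordFun_mul_structConst X p.1) x y
  rw [h1, h2, h3, bracketForm_apply]
  ring

theorem trivialBivector_eq (p : (E →L[ℝ] ℝ) × G) :
    trivialBivector I G p =
      -∑ i, wedgeField (trivialModel I) (rightField I X i) (partialField I X i) p -
      (1 / 2 : ℝ) • ∑ i, ∑ j, ∑ k, (coordFun I X i p.1 * structConst I X i j k) •
        wedgeField (trivialModel I) (partialField I X j) (partialField I X k) p := by
  let R : ι → (E →L[ℝ] ℝ) × E := fun i => (0, rightInvEnd I p.2 (modelBasis X i))
  let D : ι → (E →L[ℝ] ℝ) × E := fun i => (dualVec I X i, 0)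
  change (show (((E →L[ℝ] ℝ) × E) →L[ℝ] ℝ) [⋀^Fin 2]→L[ℝ] ℝ from trivialBivector I G p) =
    -∑ i, vecWedge (R i) (D i) - (1 / 2 : ℝ) • ∑ i, ∑ j, ∑ k,
      (coordFun I X i p.1 * structConst I X i j k) • vecWedge (D j) (D k)
  have hflat : ∀ F : ((E →L[ℝ] ℝ) × E) →L[ℝ] ℝ, ∃ a x,
      F = flat (V := (E →L[ℝ] ℝ) × E) (trivialForm I G p) (a, rightInvEnd I p.2 x) := by
    intro F
    obtain ⟨u, hu⟩ := (isNondegenerate_trivialForm (I := I) p).2 F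
    refine ⟨u.1, maurerCartanEnd I p.2 u.2, ?_⟩
    rw [rightInvEnd_maurerCartanEnd]
    exact hu.symm
  ext F
  obtain ⟨a, x, hu⟩ := hflat (F 0)
  obtain ⟨b, y, hv⟩ := hflat (F 1)
  have hF : F = ![flat (V := (E →L[ℝ] ℝ) × E) (trivialForm I G p) (a, rightInvEnd I p.2 x),
      flat (V := (E →L[ℝ] ℝ) × E) (trivialForm I G p) (b, rightInvEnd I p.2 y)] := by
    ext i : 1
    fin_cases i
    · exact hu
    · exact hv
  have hR : ∀ (a : E →L[ℝ] ℝ) (x : E) (i : ι),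
      flat (V := (E →L[ℝ] ℝ) × E) (trivialForm I G p) (a, rightInvEnd I p.2 x) (R i) =
        a (modelBasis X i) + bracketForm I G p.1 x (modelBasis X i) := by
    intro a x i
    refine ((flat_apply _ _ _).trans (trivialForm_apply p a 0 x (modelBasis X i))).trans ?_
    rw [bracketForm_apply]
    simp
  have hD : ∀ (a : E →L[ℝ] ℝ) (x : E) (i : ι),
      flat (V := (E →L[ℝ] ℝ) × E) (trivialForm I G p) (a, rightInvEnd I p.2 x) (D i) =
        -(modelBasis X).repr x i := by
    intro a x i
    have h := trivialForm_apply (I := I) p a (dualVec I X i) x 0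
    rw [_root_.map_zero, ← bracketForm_apply, _root_.map_zero, _root_.map_zero, zero_sub, add_zero] at h
    exact (flat_apply _ _ _).trans h
  rw [hF, trivialBivector_flat, trivialForm_apply]
  simp only [ContinuousAlternatingMap.sub_apply, ContinuousAlternatingMap.neg_apply,
    ContinuousAlternatingMap.sum_apply,
    ContinuousAlternatingMap.smul_apply, vecWedge_apply, hR, hD,
    smul_eq_mul, Finset.sum_sub_distrib]
  have h1 : ∑ i, (a (modelBasis X i) + bracketForm I G p.1 x (modelBasis X i)) *
      (modelBasis X).repr y i = a y + bracketForm I G p.1 x y :=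
    sum_basis_mul_repr (modelBasis X) (a + bracketForm I G p.1 x : E →ₗ[ℝ] ℝ) y
  have h2 : ∑ i, (b (modelBasis X i) + bracketForm I G p.1 y (modelBasis X i)) *
      (modelBasis X).repr x i = b x + bracketForm I G p.1 y x :=
    sum_basis_mul_repr (modelBasis X) (b + bracketForm I G p.1 y : E →ₗ[ℝ] ℝ) x
  have h3 := sum_structConst_mul (modelBasis X) (bracketForm I G p.1) (bracketForm_swap p.1)
    (fun i j k => coordFun I X i p.1 * structConst I X i j k)
    (sum_coordFun_mul_structConst X p.1) x y
  simp only [mul_neg, neg_mul, neg_neg, Finset.sum_neg_distrib]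
  rw [h1, h2, h3, bracketForm_swap p.1 x y, bracketForm_apply]
  ring

theorem neg_bivectorBracket_eq (f g : (E →L[ℝ] ℝ) × G → ℝ) (p : (E →L[ℝ] ℝ) × G) :
    -bivectorBracket (trivialModel I) (trivialBivector I G) f g p =
      ∑ i, derivAlong (trivialModel I) (rightField I X i) f p *
        derivAlong (trivialModel I) (partialField I X i) g p -
      ∑ i, derivAlong (trivialModel I) (rightField I X i) g p *
        derivAlong (trivialModel I) (partialField I X i) f p +
      ∑ i, ∑ j, ∑ k, coordFun I X i p.1 * structConst I X i j k *
        derivAlong (trivialModel I) (partialField I X j) f p *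
        derivAlong (trivialModel I) (partialField I X k) g p := by
  let R : ι → (E →L[ℝ] ℝ) × E := fun i => rightField I X i p
  let D : ι → (E →L[ℝ] ℝ) × E := fun i => partialField I X i p
  let F : ((E →L[ℝ] ℝ) × E) →L[ℝ] ℝ := dFun (trivialModel I) f p
  let K : ((E →L[ℝ] ℝ) × E) →L[ℝ] ℝ := dFun (trivialModel I) g p
  have h : bivectorBracket (trivialModel I) (trivialBivector I G) f g p =
      (-∑ i, vecWedge (R i) (D i) - (1 / 2 : ℝ) • ∑ i, ∑ j, ∑ k,
        (coordFun I X i p.1 * structConst I X i j k) • vecWedge (D j) (D k)) ![F, K] :=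
    congrArg (fun L : (((E →L[ℝ] ℝ) × E) →L[ℝ] ℝ) [⋀^Fin 2]→L[ℝ] ℝ => L ![F, K])
      (trivialBivector_eq X p)
  change _ = ∑ i, F (R i) * K (D i) - ∑ i, K (R i) * F (D i) +
    ∑ i, ∑ j, ∑ k, coordFun I X i p.1 * structConst I X i j k * F (D j) * K (D k)
  have hswap : ∑ i, ∑ j, ∑ k, coordFun I X i p.1 * structConst I X i j k * (K (D j) * F (D k)) =
      -∑ i, ∑ j, ∑ k, coordFun I X i p.1 * structConst I X i j k * (F (D j) * K (D k)) := by
    rw [← Finset.sum_neg_distrib]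
    refine Finset.sum_congr rfl fun i _ => ?_
    rw [Finset.sum_comm, ← Finset.sum_neg_distrib]
    refine Finset.sum_congr rfl fun k _ => ?_
    rw [← Finset.sum_neg_distrib]
    refine Finset.sum_congr rfl fun j _ => ?_
    rw [structConst_swap]
    ring
  rw [h]
  simp only [ContinuousAlternatingMap.sub_apply, ContinuousAlternatingMap.neg_apply,
    ContinuousAlternatingMap.sum_apply,
    ContinuousAlternatingMap.smul_apply, vecWedge_apply,
    smul_eq_mul, Finset.sum_sub_distrib, mul_sub, mul_assoc]
  simp only [mul_assoc] at hswap
  rw [hswap]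
  ring

end BasisFormulas

end

theorem mainTheorem5
    {E : Type*} [NormedAddCommGroup E] [NormedSpace ℝ E] [FiniteDimensional ℝ E]
    {H : Type*} [TopologicalSpace H] (I : ModelWithCorners ℝ E H) [I.Boundaryless]
    (G : Type*) [TopologicalSpace G] [ChartedSpace H G] [Group G] [LieGroup I ∞ G]
    {ι : Type*} [Fintype ι] (X : Module.Basis ι ℝ (GroupLieAlgebra I G)) :
    -- `(ζ^l, π)` is a diffeomorphism with the stated inverse
    (∃ Φ : Diffeomorph (cotangentModel I) (trivialModel I) (Cotangent I G)
        ((E →L[ℝ] ℝ) × G) ∞,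
      (∀ ξ, Φ ξ = rightTrivialization I G ξ) ∧
      (∀ p, Φ.symm p = rightTrivializationInv I G p)) ∧
    -- the semidirect product is a Lie group
    (∃ grp : Group ((E →L[ℝ] ℝ) × G),
      (∀ p q, grp.mul p q = semidirectMul I p q) ∧
      (∀ p, grp.inv p = semidirectInv I p) ∧
      @LieGroup ℝ _ _ _ _ _ _ (trivialModel I) ∞ ((E →L[ℝ] ℝ) × G) grp _ _) ∧
    -- the induced Lie group structure on `T^*G`
    (∃ grp : Group (Cotangent I G),
      (∀ ξ η, rightTrivialization I G (grp.mul ξ η) =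
        semidirectMul I (rightTrivialization I G ξ) (rightTrivialization I G η)) ∧
      @LieGroup ℝ _ _ _ _ _ _ (cotangentModel I) ∞ (Cotangent I G) grp _ _) ∧
    -- conjugation by elements of `G`
    (∀ (g : G) (ξ : Cotangent I G),
      rightTrivialization I G (cotangentConj I g ξ) =
        (coadjointRep I g (rightTrivialization I G ξ).1, g * ξ.proj * g⁻¹) ∧
      rightTrivialization I G (cotangentConj I g ξ) =
        semidirectMul I (semidirectMul I (0, g) (rightTrivialization I G ξ))
          (semidirectInv I (0, g))) ∧
    -- `ω` and `ω^r` are nondegenerate, so that `Λ = ω⁻¹` makes sense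
    IsNondegenerate (cotangentModel I) (cotangentForm I G) ∧
    IsNondegenerate (trivialModel I) (trivialForm I G) ∧
    -- the symplectic form
    (∀ p : (E →L[ℝ] ℝ) × G,
      trivialForm I G p =
        ∑ i, wedgeForm (trivialModel I) (dCoord I X i) (kappa I X i) p +
        (1 / 2 : ℝ) • ∑ i, ∑ j, ∑ k, (coordFun I X i p.1 * structConst I X i j k) •
          wedgeForm (trivialModel I) (kappa I X j) (kappa I X k) p) ∧
    -- the Poisson bivector
    (∀ p : (E →L[ℝ] ℝ) × G,
      trivialBivector I G p =
        -∑ i, wedgeField (trivialModel I) (rightField I X i) (partialField I X i) p -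
        (1 / 2 : ℝ) • ∑ i, ∑ j, ∑ k, (coordFun I X i p.1 * structConst I X i j k) •
          wedgeField (trivialModel I) (partialField I X j) (partialField I X k) p) ∧
    -- the Poisson bracket
    (∀ f g : (E →L[ℝ] ℝ) × G → ℝ,
      ContMDiff (trivialModel I) 𝓘(ℝ, ℝ) ∞ f → ContMDiff (trivialModel I) 𝓘(ℝ, ℝ) ∞ g →
      ∀ p : (E →L[ℝ] ℝ) × G,
        -bivectorBracket (trivialModel I) (trivialBivector I G) f g p =
          ∑ i, derivAlong (trivialModel I) (rightField I X i) f p *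
            derivAlong (trivialModel I) (partialField I X i) g p -
          ∑ i, derivAlong (trivialModel I) (rightField I X i) g p *
            derivAlong (trivialModel I) (partialField I X i) f p +
          ∑ i, ∑ j, ∑ k, coordFun I X i p.1 * structConst I X i j k *
            derivAlong (trivialModel I) (partialField I X j) f p *
            derivAlong (trivialModel I) (partialField I X k) g p) := by
  refine ⟨⟨rightTrivializationDiffeomorph I G, fun _ => rfl, fun _ => rfl⟩,
    ⟨semidirectGroup I G, fun _ _ => rfl, fun _ => rfl, lieGroup_semidirect⟩,
    ⟨cotangentGroup I G, fun ξ η => ?_, lieGroup_cotangent⟩,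
    fun g ξ => ⟨rightTrivialization_cotangentConj g ξ, ?_⟩,
    isNondegenerate_cotangentForm, isNondegenerate_trivialForm, trivialForm_eq X,
    trivialBivector_eq X, fun f g _ _ p => neg_bivectorBracket_eq X f g p⟩
  · exact (rightTrivializationEquiv I G).apply_symm_apply _
  · rw [rightTrivialization_cotangentConj, semidirectMul_conj]
    rfl
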